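/- Let $F$ be a non-Archimedean local field with ring of integers $\mathcal{O}$, maximal ideal $\mathfrak{p}$, normalized discrete valuation $\nu$ and residue field $\mathcal{O}/\mathfrak{p}$ of cardinality $q=p^f$, where $p$ is a prime and $f$ is the absolute inertia degree of $F$. Let $e=\nu(p)\in\{1,2,\dots\}\cup\{\infty\}$ be the absolute ramification index of $F$ (so $e=\infty$ if $F$ has characteristic $p$). For integers $k,n\ge 0$ put $\xi=\min\{e,n\}$ and let $\mathrm{Hei}_{2k+1}(\mathcal{O}/\mathfrak{p}^n)$ be the Heisenberg group, that is, the group of all $(k+2)\times(k+2)$ matrices $$\begin{pmatrix}1&\mathbf{x}&z\\0&I_k&\mathbf{y}^T\\0&0&1\end{pmatrix},\qquad \mathbf{x},\mathbf{y}\in(\mathcal{O}/\mathfrak{p}^n)^k,\ z\in\mathcal{O}/\mathfrak{p}^n.$$ Then the smallest $d\ge 0$ for which $\mathrm{Hei}_{2k+1}(\mathcal{O}/\mathfrak{p}^n)$ has a faithful complex representation of dimension $d$, i.e. embeds into $\mathrm{GL}_d(\mathbb{C})$, equals $$\sum_{i=0}^{\xi-1} f\,q^{k(n-i)}.$$ 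-/

import Mathlib

open scoped ValuativeRel

namespace HeisenbergFaithful

section Heisenberg

/-- The square matrix of size `k + 2` (rows and columns indexed by `1 + (k + 1)`)
whose block rows are `(1, x, z)`, `(0, I, yᵀ)`, `(0, 0, 1)`. -/
def heisMatrix {R : Type*} [CommRing R] {k : ℕ} (x y : Fin k → R) (z : R) :
    Matrix (Unit ⊕ (Fin k ⊕ Unit)) (Unit ⊕ (Fin k ⊕ Unit)) R :=
  Matrix.fromBlocks 1 (Matrix.fromCols (Matrix.replicateRow Unit x) (Matrix.of fun _ _ => z))
    0 (Matrix.fromBlocks 1 (Matrix.replicateCol Unit y) 0 1)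

theorem heisMatrix_mul {R : Type*} [CommRing R] {k : ℕ} (x y x' y' : Fin k → R) (z z' : R) :
    heisMatrix x y z * heisMatrix x' y' z' =
      heisMatrix (x + x') (y + y') (z + z' + x ⬝ᵥ y') := by
  ext i j
  rcases i with i | i | i <;> rcases j with j | j | j <;>
    simp [heisMatrix, Matrix.mul_apply, Fintype.sum_sum_type, Matrix.one_apply, dotProduct] <;>
    ring

theorem heisMatrix_zero {R : Type*} [CommRing R] {k : ℕ} : heisMatrix (0 : Fin k → R) 0 0 = 1 := by
  ext i j
  rcases i with i | i | i <;> rcases j with j | j | j <;>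
    simp [heisMatrix, Matrix.one_apply]

/-- The Heisenberg group `Hei_{2k+1}(R)`, as a group of invertible matrices of size `k + 2`. -/
def Heis (k : ℕ) (R : Type*) [CommRing R] :
    Subgroup (Matrix.GeneralLinearGroup (Unit ⊕ (Fin k ⊕ Unit)) R) where
  carrier := {g | ∃ (x y : Fin k → R) (z : R), g.val = heisMatrix x y z}
  one_mem' := ⟨0, 0, 0, by rw [heisMatrix_zero]; rfl⟩
  mul_mem' := by
    rintro a b ⟨x, y, z, h⟩ ⟨x', y', z', h'⟩
    exact ⟨_, _, _, by rw [Units.val_mul, h, h', heisMatrix_mul]⟩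
  inv_mem' := by
    rintro a ⟨x, y, z, h⟩
    refine ⟨-x, -y, -z + x ⬝ᵥ y, ?_⟩
    refine Units.inv_eq_of_mul_eq_one_right ?_
    rw [h, heisMatrix_mul, ← heisMatrix_zero]
    congr 1 <;> simp

end Heisenberg

/-- `d` is the dimension of some faithful complex representation of `G`. -/
def HasFaithfulRepOfDim (G : Type*) [Group G] (d : ℕ) : Prop :=
  ∃ ρ : G →* Matrix.GeneralLinearGroup (Fin d) ℂ, Function.Injective ρ

section LocalField

variable (F : Type*) [Field F] [ValuativeRel F] [TopologicalSpace F]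
  [IsNonarchimedeanLocalField F]

/-- The normalized valuation `ν(p)` of the integer `p`, an element of `ℕ ∪ {∞}`. For `p` the
residue characteristic of `F`, it is the absolute ramification index of `F`. -/
noncomputable def absRamificationIndex (p : ℕ) : ℕ∞ :=
  IsDiscreteValuationRing.addVal 𝒪[F] (p : 𝒪[F])

/-- `ξ = min {ν(p), n}`, a natural number since it is at most `n`. -/
noncomputable def xi (p n : ℕ) : ℕ :=
  (min (absRamificationIndex F p) (n : ℕ∞)).toNat

end LocalField

end HeisenbergFaithful

/-! Write 𝔪 for the maximal ideal; the level of a character ψ of O/𝔪^n is the least m with ψ trivial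
on 𝔪^m. Lower bound: restrict a faithful representation to the abelian normal subgroup x = 0.
Conjugation by (x, 0, 0) multiplies a character lying over the central character ψ by y ↦ ψ(x·y), so
ψ costs at least q^(k·level ψ) dimensions (`exists_centralChars_of_hasFaithfulRepOfDim`,
`pow_charLevel_le_ncard_pairings`). For j ≤ ξ the group 𝔪^(n-j)/𝔪^n is killed by p and has order
p^(fj); only characters of level > n-j are nontrivial on it, so at least fj of these occur. The
cheapest choice is f characters of each level n, n-1, ..., n-ξ+1 (`sum_weight_ge`). Upper bound: for
each m = n-i with i < ξ, choose f characters separating 𝔪^(m-1)/𝔪^m and sum their Schrödinger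
representations on functions on (O/𝔪^m)^k. Every nonzero p-torsion element of the centre has
valuation m-1 for such an m, so the sum is faithful on the centre, hence faithful
(`schroedinger_injective`). -/

namespace HeisenbergFaithful

/-! ### Characters of a finite abelian group acting on a complex space. -/

section FiniteAbelian

variable {A : Type*} [AddCommGroup A] [Finite A] {V : Type*} [AddCommGroup V] [Module ℂ V]

/-- `χ` occurs in the representation `T` if it has a nonzero eigenvector. -/
def Occurs (T : Multiplicative A →* Module.End ℂ V) (χ : AddChar A ℂ) : Prop :=
  ∃ v : V, v ≠ 0 ∧ ∀ a, T (Multiplicative.ofAdd a) v = χ a • v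

/-- The (unnormalized) projection to the `χ`-isotypic part. -/
noncomputable def isotypicSum (T : Multiplicative A →* Module.End ℂ V) (χ : AddChar A ℂ) :
    Module.End ℂ V :=
  letI := Fintype.ofFinite A
  ∑ a, χ (-a) • T (Multiplicative.ofAdd a)

theorem apply_isotypicSum (T : Multiplicative A →* Module.End ℂ V) (χ : AddChar A ℂ) (b : A)
    (v : V) : T (Multiplicative.ofAdd b) (isotypicSum T χ v) = χ b • isotypicSum T χ v := by
  let _ := Fintype.ofFinite A
  simp only [isotypicSum, LinearMap.sum_apply, LinearMap.smul_apply, map_sum, map_smul,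
    Finset.smul_sum, smul_smul]
  rw [← Equiv.sum_comp (Equiv.addLeft b) (fun a => (χ b * χ (-a)) • T (Multiplicative.ofAdd a) v)]
  refine Finset.sum_congr rfl fun a _ => ?_
  rw [Equiv.coe_addLeft, ofAdd_add, map_mul, Module.End.mul_apply, ← AddChar.map_add_eq_mul]
  congr 2
  simp

theorem sum_isotypicSum [Fintype (AddChar A ℂ)] (T : Multiplicative A →* Module.End ℂ V) (v : V) :
    ∑ χ : AddChar A ℂ, isotypicSum T χ v = (Nat.card A : ℂ) • v := by
  classical
  let _ := Fintype.ofFinite A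
  simp only [isotypicSum, LinearMap.sum_apply, LinearMap.smul_apply]
  rw [Finset.sum_comm]
  simp only [← Finset.sum_smul]
  have h (a : A) : ∑ χ : AddChar A ℂ, χ (-a) = if a = 0 then (Nat.card A : ℂ) else 0 := by
    rw [Nat.card_eq_fintype_card, ← neg_eq_zero (a := a), ← AddChar.sum_apply_eq_ite]
    exact Finset.sum_congr (by ext; simp) fun _ _ => rfl
  simp [h]

theorem isotypicSum_apply_of_eigenvector (T : Multiplicative A →* Module.End ℂ V)
    (χ χ' : AddChar A ℂ) [Decidable (χ' = χ)] {v : V}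
    (hv : ∀ a, T (Multiplicative.ofAdd a) v = χ' a • v) :
    isotypicSum T χ v = if χ' = χ then (Nat.card A : ℂ) • v else 0 := by
  classical
  let _ := Fintype.ofFinite A
  simp only [isotypicSum, LinearMap.sum_apply, LinearMap.smul_apply, hv, smul_smul,
    ← Finset.sum_smul]
  have h : ∑ a, χ (-a) * χ' a = if χ' = χ then (Nat.card A : ℂ) else 0 := by
    have := AddChar.sum_eq_ite (χ' - χ)
    simp only [sub_eq_zero, AddChar.sub_apply'] at this
    rw [Nat.card_eq_fintype_card, ← this]
    refine Finset.sum_congr rfl fun a _ => ?_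
    rw [AddChar.map_neg_eq_inv, div_eq_mul_inv, mul_comm]
  rw [h]
  split_ifs <;> simp

/-- The isotypic components of a vector sum to `Nat.card A` times it; if every occurring character
is trivial at `a`, all of them are fixed by `a`. -/
theorem exists_occurs_apply_ne_one (T : Multiplicative A →* Module.End ℂ V) {a : A}
    (ha : T (Multiplicative.ofAdd a) ≠ 1) : ∃ χ, Occurs T χ ∧ χ a ≠ 1 := by
  classical
  let _ := Fintype.ofFinite A
  have : Fintype (AddChar A ℂ) := Fintype.ofFinite _
  by_contra! H
  refine ha (LinearMap.ext fun v => ?_)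
  have hfix (χ : AddChar A ℂ) :
      T (Multiplicative.ofAdd a) (isotypicSum T χ v) = isotypicSum T χ v := by
    by_cases h0 : isotypicSum T χ v = 0
    · simp [h0]
    · rw [apply_isotypicSum, H χ ⟨_, h0, fun b => apply_isotypicSum T χ b v⟩, one_smul]
  have hcard : (Nat.card A : ℂ) ≠ 0 := Nat.cast_ne_zero.2 Nat.card_pos.ne'
  have := congrArg (T (Multiplicative.ofAdd a)) (sum_isotypicSum T v)
  rw [map_sum, Finset.sum_congr rfl fun χ _ => hfix χ, sum_isotypicSum, map_smul] at this
  exact (smul_right_injective V hcard this).symm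

theorem card_occurs_le_finrank [FiniteDimensional ℂ V] (T : Multiplicative A →* Module.End ℂ V) :
    Nat.card {χ // Occurs T χ} ≤ Module.finrank ℂ V := by
  classical
  let _ := Fintype.ofFinite {χ // Occurs T χ}
  choose v hv hT using fun χ : {χ // Occurs T χ} => χ.2
  have hcard : (Nat.card A : ℂ) ≠ 0 := Nat.cast_ne_zero.2 Nat.card_pos.ne'
  have : LinearIndependent ℂ v := by
    rw [Fintype.linearIndependent_iff]
    intro g hg χ
    have := congrArg (isotypicSum T χ.1) hg
    rw [map_sum, map_zero, Finset.sum_eq_single χ] at this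
    · rw [map_smul, isotypicSum_apply_of_eigenvector T χ.1 χ.1 (hT χ), if_pos rfl] at this
      simpa [hcard, hv χ] using this
    · intro χ' _ hne
      rw [map_smul, isotypicSum_apply_of_eigenvector T χ.1 χ'.1 (hT χ'),
        if_neg (Subtype.coe_injective.ne hne), smul_zero]
    · simp
  rw [Nat.card_eq_fintype_card]
  exact this.fintype_card_le_finrank

end FiniteAbelian

/-! ### Coordinates on the Heisenberg group. -/

section Elements

variable {R : Type*} [CommRing R] {k : ℕ}

/-- The element of the Heisenberg group with given coordinates. -/
def heisMk (x y : Fin k → R) (z : R) : Heis k R :=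
  ⟨⟨heisMatrix x y z, heisMatrix (-x) (-y) (-z + x ⬝ᵥ y),
    by rw [heisMatrix_mul, ← heisMatrix_zero]; congr 1 <;> simp,
    by rw [heisMatrix_mul, ← heisMatrix_zero]; congr 1 <;> simp⟩, x, y, z, rfl⟩

theorem heisMk_mul (x y x' y' : Fin k → R) (z z' : R) :
    heisMk x y z * heisMk x' y' z' = heisMk (x + x') (y + y') (z + z' + x ⬝ᵥ y') :=
  Subtype.ext (Units.ext (heisMatrix_mul x y x' y' z z'))

theorem heisMk_zero : heisMk (0 : Fin k → R) 0 0 = 1 :=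
  Subtype.ext (Units.ext heisMatrix_zero)

/-- The first row of an element of the Heisenberg group. -/
def heisX (g : Heis k R) (i : Fin k) : R := g.1.1 (.inl ()) (.inr (.inl i))

/-- The last column of an element of the Heisenberg group. -/
def heisY (g : Heis k R) (i : Fin k) : R := g.1.1 (.inr (.inl i)) (.inr (.inr ()))

/-- The corner entry of an element of the Heisenberg group. -/
def heisZ (g : Heis k R) : R := g.1.1 (.inl ()) (.inr (.inr ()))

@[simp] theorem heisX_heisMk (x y : Fin k → R) (z : R) : heisX (heisMk x y z) = x := by
  ext; simp [heisX, heisMk, heisMatrix]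

@[simp] theorem heisY_heisMk (x y : Fin k → R) (z : R) : heisY (heisMk x y z) = y := by
  ext; simp [heisY, heisMk, heisMatrix]

@[simp] theorem heisZ_heisMk (x y : Fin k → R) (z : R) : heisZ (heisMk x y z) = z := by
  simp [heisZ, heisMk, heisMatrix]

theorem exists_eq_heisMk (g : Heis k R) : ∃ x y z, g = heisMk x y z := by
  obtain ⟨g, x, y, z, h⟩ := g
  exact ⟨x, y, z, Subtype.ext (Units.ext h)⟩

end Elements

/-! ### Conjugation orbits of characters over a central character. -/

section LowerBound

variable {R : Type*} [CommRing R] {k : ℕ}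

/-- The abelian subgroup `x = 0` of the Heisenberg group. -/
def heisAbelian : Multiplicative ((Fin k → R) × R) →* Heis k R where
  toFun a := heisMk 0 a.toAdd.1 a.toAdd.2
  map_one' := heisMk_zero
  map_mul' a b := by simp [heisMk_mul]

/-- The linear forms `y ↦ ψ (x ⬝ᵥ y)`. -/
def pairings (k : ℕ) (ψ : AddChar R ℂ) : Set ((Fin k → R) → ℂ) :=
  Set.range fun x y => ψ (x ⬝ᵥ y)

/-- Translation of a character of `heisAbelian` by conjugation with an element `(x, 0, 0)`. -/
def shiftChar (x : Fin k → R) (χ : AddChar ((Fin k → R) × R) ℂ) : AddChar ((Fin k → R) × R) ℂ where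
  toFun a := χ (a.1, a.2 + x ⬝ᵥ a.1)
  map_zero_eq_one' := (congrArg χ (by simp)).trans χ.map_zero_eq_one
  map_add_eq_mul' a b := by
    rw [← AddChar.map_add_eq_mul]
    congr 1
    ext <;> simp [dotProduct_add]
    ring

/-- The restriction of a character of `heisAbelian` to the centre. -/
def centralChar (χ : AddChar ((Fin k → R) × R) ℂ) : AddChar R ℂ :=
  χ.compAddMonoidHom (AddMonoidHom.inr (Fin k → R) R)

theorem centralChar_apply (χ : AddChar ((Fin k → R) × R) ℂ) (z : R) :
    centralChar χ z = χ (0, z) := rfl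

/-- Since `heisAbelian` has normal image, `T (heisMk (-x) 0 0)` carries eigenvectors to eigenvectors
of the conjugated character. -/
theorem Occurs.shiftChar {V : Type*} [AddCommGroup V] [Module ℂ V]
    {T : Heis k R →* Module.End ℂ V} {χ : AddChar ((Fin k → R) × R) ℂ}
    (h : Occurs (T.comp heisAbelian) χ) (x : Fin k → R) :
    Occurs (T.comp heisAbelian) (shiftChar x χ) := by
  obtain ⟨v, hv, hT⟩ := h
  have hinv : T (heisMk x 0 0) * T (heisMk (-x) 0 0) = 1 := by
    rw [← map_mul, heisMk_mul, ← map_one T, ← heisMk_zero]; simp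
  have hinv' : T (heisMk (-x) 0 0) * T (heisMk x 0 0) = 1 := by
    rw [← map_mul, heisMk_mul, ← map_one T, ← heisMk_zero]; simp
  refine ⟨T (heisMk (-x) 0 0) v, fun h0 => hv ?_, fun a => ?_⟩
  · rw [← Module.End.one_apply (R := ℂ) v, ← hinv, Module.End.mul_apply, h0, map_zero]
  · have hcomm : heisAbelian (Multiplicative.ofAdd a) * heisMk (-x) 0 0 =
        heisMk (-x) 0 0 * heisAbelian (Multiplicative.ofAdd (a.1, a.2 + x ⬝ᵥ a.1)) := by
      simp [heisAbelian, heisMk_mul]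
    rw [MonoidHom.comp_apply, ← Module.End.mul_apply, ← map_mul, hcomm, map_mul,
      Module.End.mul_apply]
    have := hT (a.1, a.2 + x ⬝ᵥ a.1)
    rw [MonoidHom.comp_apply] at this
    rw [this, map_smul]
    rfl

/-- The central characters of a faithful representation separate the points of the centre, and
each contributes at least as many dimensions as it has pairings. -/
theorem exists_centralChars_of_hasFaithfulRepOfDim [Finite R] {d : ℕ}
    (h : HasFaithfulRepOfDim (Heis k R) d) :
    ∃ S : Finset (AddChar R ℂ), (∀ z ≠ 0, ∃ ψ ∈ S, ψ z ≠ 1) ∧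
      ∑ ψ ∈ S, (pairings k ψ).ncard ≤ d := by
  classical
  obtain ⟨ρ, hρ⟩ := h
  let T : Heis k R →* Module.End ℂ (Fin d → ℂ) :=
    ((Matrix.toLinAlgEquiv' : Matrix (Fin d) (Fin d) ℂ ≃ₐ[ℂ] _) : _ →* _).comp
      ((Units.coeHom _).comp ρ)
  have hT : Function.Injective T :=
    Matrix.toLinAlgEquiv'.injective.comp (Units.val_injective.comp hρ)
  let X : Finset (AddChar ((Fin k → R) × R) ℂ) :=
    (Set.toFinite {χ | Occurs (T.comp heisAbelian) χ}).toFinset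
  have hX (χ) : χ ∈ X ↔ Occurs (T.comp heisAbelian) χ := by simp [X]
  refine ⟨X.image centralChar, fun z hz => ?_, ?_⟩
  · obtain ⟨χ, hχ, h1⟩ := exists_occurs_apply_ne_one (T.comp heisAbelian) (a := (0, z)) (by
      intro h1
      rw [← map_one T] at h1
      have := congrArg heisZ (hT h1)
      rw [← heisMk_zero] at this
      simp [heisAbelian] at this
      exact hz this)
    exact ⟨_, Finset.mem_image_of_mem _ ((hX χ).2 hχ), h1⟩
  · calc ∑ ψ ∈ X.image centralChar, (pairings k ψ).ncard
        ≤ ∑ ψ ∈ X.image centralChar, (X.filter fun χ => centralChar χ = ψ).card := by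
          refine Finset.sum_le_sum fun ψ hψ => ?_
          obtain ⟨χ, hχ, rfl⟩ := Finset.mem_image.1 hψ
          -- Dividing by the base character turns `shiftChar x χ` into the pairing with `x`, so the
          -- fibre over `centralChar χ` has at least as many elements as there are pairings.
          let q (χ' : AddChar ((Fin k → R) × R) ℂ) (y : Fin k → R) : ℂ :=
            χ' (y, 0) * (χ (y, 0))⁻¹
          have hsub : pairings k (centralChar χ) ⊆
              q '' (X.filter fun χ' => centralChar χ' = centralChar χ : Finset _) := by
            rintro _ ⟨x, rfl⟩
            refine ⟨shiftChar x χ, ?_, ?_⟩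
            · simp only [Finset.coe_filter, Set.mem_ofPred_eq]
              refine ⟨(hX _).2 (((hX χ).1 hχ).shiftChar x), ?_⟩
              ext z
              simp [centralChar_apply, shiftChar]
            · funext y
              have : χ (y, 0 + x ⬝ᵥ y) = χ (y, 0) * χ (0, x ⬝ᵥ y) := by
                rw [← AddChar.map_add_eq_mul]; simp
              change χ (y, 0 + x ⬝ᵥ y) * (χ (y, 0))⁻¹ = χ (0, x ⬝ᵥ y)
              rw [this, mul_right_comm, mul_inv_cancel₀, one_mul]
              exact (AddChar.val_isUnit χ _).ne_zero
          calc _ ≤ _ := Set.ncard_le_ncard hsub (Set.toFinite _)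
            _ ≤ _ := Set.ncard_image_le (Set.toFinite _)
            _ = _ := Set.ncard_coe_finset _
      _ = X.card := (Finset.card_eq_sum_card_image _ _).symm
      _ = Nat.card {χ // Occurs (T.comp heisAbelian) χ} := by
          rw [← Set.ncard_coe_finset, Set.Finite.coe_toFinset]; rfl
      _ ≤ d := by simpa using card_occurs_le_finrank (T.comp heisAbelian)

end LowerBound

/-! ### Separating characters and p-rank. -/

section Separation

variable {A : Type*} [AddCommGroup A] [Finite A] {p : ℕ}

/-- Characters separating the points of a group of exponent `p` are at least as many as its
`p`-rank. -/
theorem card_le_pow_card_of_separating (hp : p.Prime) (B : AddSubgroup A)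
    (hB : ∀ b ∈ B, p • b = 0) (S : Finset (AddChar A ℂ))
    (hS : ∀ b ∈ B, b ≠ 0 → ∃ ψ ∈ S, ψ b ≠ 1) : Nat.card B ≤ p ^ S.card := by
  have : NeZero p := ⟨hp.ne_zero⟩
  have hpow (b : B) (ψ : AddChar A ℂ) : ψ b ^ p = 1 := by
    rw [← AddChar.map_nsmul_eq_pow, hB b b.2, AddChar.map_zero_eq_one]
  let φ (b : B) (ψ : S) : rootsOfUnity p ℂ := rootsOfUnity.mkOfPowEq (ψ.1 b) (hpow b ψ)
  have hφ : Function.Injective φ := by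
    intro b c hbc
    by_contra hne
    obtain ⟨ψ, hψ, h1⟩ := hS (b - c) (B.sub_mem b.2 c.2)
      (sub_ne_zero.2 fun h => hne (Subtype.ext h))
    have h2 : ψ b = ψ c := by
      have := congrArg (fun u : rootsOfUnity p ℂ => ((u : ℂˣ) : ℂ)) (congrFun hbc ⟨ψ, hψ⟩)
      simpa [φ] using this
    refine h1 ?_
    rw [AddChar.map_sub_eq_div, h2, div_self]
    exact (ψ.val_isUnit c.1).ne_zero
  calc Nat.card B ≤ Nat.card (S → rootsOfUnity p ℂ) := Nat.card_le_card_of_injective φ hφ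
    _ = p ^ S.card := by
      rw [Nat.card_fun, Complex.card_rootsOfUnity]; simp

/-- Induction on `r`: the kernel on `B` of a character nontrivial at some `b` has index at least
`p`, and the remaining characters need only separate that kernel. -/
theorem exists_separating_chars (hp : p.Prime) (r : ℕ) (B : AddSubgroup A)
    (hB : ∀ b ∈ B, p • b = 0) (hcard : Nat.card B ≤ p ^ r) :
    ∃ ψ : Fin r → AddChar A ℂ, ∀ b ∈ B, b ≠ 0 → ∃ j, ψ j b ≠ 1 := by
  induction r generalizing B with
  | zero =>
    refine ⟨Fin.elim0, fun b hb h0 => absurd ?_ h0⟩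
    have : Subsingleton B := (Finite.card_le_one_iff_subsingleton).1 (by simpa using hcard)
    exact congrArg Subtype.val (Subsingleton.elim (⟨b, hb⟩ : B) 0)
  | succ r ih =>
    by_cases hbot : ∀ b ∈ B, b = 0
    · exact ⟨fun _ => 1, fun b hb h0 => absurd (hbot b hb) h0⟩
    push Not at hbot
    obtain ⟨b, hb, hb0⟩ := hbot
    obtain ⟨χ, hχ⟩ := AddChar.exists_apply_ne_zero.2 hb0
    let φ : B →+ Additive ℂˣ :=
      { toFun := fun b => Additive.ofMul (χ.val_isUnit b.1).unit
        map_zero' := by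
          apply Additive.toMul.injective; ext; simp
        map_add' := fun a b => by
          apply Additive.toMul.injective; ext; simp [AddChar.map_add_eq_mul] }
    have hφ (b : B) : φ b = 0 ↔ χ b.1 = 1 := by
      rw [← Additive.toMul.injective.eq_iff, Units.ext_iff]; rfl
    let K : AddSubgroup A := φ.ker.map B.subtype
    have hK (a : A) : a ∈ K ↔ a ∈ B ∧ χ a = 1 := by
      simp only [K, AddSubgroup.mem_map, AddMonoidHom.mem_ker, hφ]
      constructor
      · rintro ⟨x, h1, rfl⟩; exact ⟨x.2, h1⟩
      · rintro ⟨h1, h2⟩; exact ⟨⟨a, h1⟩, h2, rfl⟩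
    have hKcard : Nat.card K ≤ p ^ r := by
      have h1 : Nat.card K = Nat.card φ.ker := Nat.card_congr
        (φ.ker.equivMapOfInjective B.subtype B.subtype_injective).symm.toEquiv
      have h2 := AddSubgroup.card_eq_card_quotient_mul_card_addSubgroup φ.ker
      have h3 : p ≤ Nat.card (B ⧸ φ.ker) := by
        let c : B ⧸ φ.ker := QuotientAddGroup.mk (⟨b, hb⟩ : B)
        have hc0 : c ≠ 0 := by
          intro h
          exact hχ ((hφ _).1 ((QuotientAddGroup.eq_zero_iff _).1 h))
        have hpc : p • c = 0 := by
          have : p • (⟨b, hb⟩ : B) = 0 := Subtype.ext (hB b hb)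
          have h := congrArg (QuotientAddGroup.mk' φ.ker) this
          rwa [map_nsmul, map_zero] at h
        have : addOrderOf c = p := addOrderOf_eq_prime (hp := ⟨hp⟩) hpc hc0
        rw [← this]
        exact Nat.le_of_dvd Nat.card_pos (addOrderOf_dvd_natCard c)
      rw [h1]
      refine Nat.le_of_mul_le_mul_left ?_ hp.pos
      calc p * Nat.card φ.ker ≤ Nat.card (B ⧸ φ.ker) * Nat.card φ.ker := Nat.mul_le_mul_right _ h3
        _ = Nat.card B := h2.symm
        _ ≤ p * p ^ r := by rw [← pow_succ']; exact hcard
    obtain ⟨ψ, hψ⟩ := ih K (fun a ha => hB a ((hK a).1 ha).1) hKcard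
    refine ⟨Fin.cons χ ψ, fun a ha h0 => ?_⟩
    by_cases h1 : χ a = 1
    · obtain ⟨j, hj⟩ := hψ a ((hK a).2 ⟨ha, h1⟩) h0
      exact ⟨j.succ, by simpa using hj⟩
    · exact ⟨0, by simpa using h1⟩

end Separation

/-- A greedy estimate: if for each `j` at least `f * j` elements of `S` have level more than
`n - j`, then weights increasing with the level sum to at least the greedy value. -/
theorem sum_weight_ge {ι : Type*} (S : Finset ι) (level : ι → ℕ) (w : ℕ → ℕ) (hw : Monotone w)
    (f n ξ : ℕ) (hξ : ξ ≤ n) (hlevel : ∀ i ∈ S, level i ≤ n)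
    (h : ∀ j ≤ ξ, f * j ≤ (S.filter fun i => n - j < level i).card) :
    ∑ i ∈ Finset.range ξ, f * w (n - i) ≤ ∑ i ∈ S, w (level i) := by
  -- The induction carries the surplus over `f * j`, each surplus element counted at the lower
  -- weight `w (n - j)`; by `h` the subtraction never truncates.
  suffices H : ∀ j ≤ ξ, ∑ i ∈ Finset.range j, f * w (n - i) +
      ((S.filter fun i => n - j < level i).card - f * j) * w (n - j) ≤
      ∑ i ∈ S.filter (fun i => n - j < level i), w (level i) by
    refine (Nat.le_add_right _ _).trans ((H ξ le_rfl).trans ?_)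
    exact Finset.sum_le_sum_of_subset (Finset.filter_subset _ _)
  intro j hj
  induction j with
  | zero =>
    have : S.filter (fun i => n - 0 < level i) = ∅ :=
      Finset.filter_eq_empty_iff.2 fun i hi => by have := hlevel i hi; omega
    rw [this]
    simp
  | succ j ih =>
    have ih := ih (by omega)
    have hj' := h j (by omega)
    have hj'' := h (j + 1) hj
    have hsplit : S.filter (fun i => n - (j + 1) < level i) =
        (S.filter fun i => n - j < level i).disjUnion (S.filter fun i => level i = n - j) (by
          rw [Finset.disjoint_filter]; intros; omega) := by
      ext i
      simp only [Finset.mem_disjUnion, Finset.mem_filter, ← and_or_left]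
      exact and_congr_right fun _ => by omega
    rw [hsplit, Finset.card_disjUnion] at hj'' ⊢
    have hconst : ∑ i ∈ S.filter (fun i => level i = n - j), w (level i) =
        (S.filter fun i => level i = n - j).card * w (n - j) :=
      Finset.sum_const_nat fun i hi => by rw [(Finset.mem_filter.1 hi).2]
    rw [Finset.sum_disjUnion, Finset.sum_range_succ, hconst]
    refine le_trans ?_ (Nat.add_le_add_right ih _)
    generalize (S.filter fun i => n - j < level i).card = a at *
    generalize (S.filter fun i => level i = n - j).card = b at *
    have hmono : w (n - (j + 1)) ≤ w (n - j) := hw (by omega)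
    have key : f * w (n - j) + (a + b - f * (j + 1)) * w (n - (j + 1)) ≤
        (a - f * j) * w (n - j) + b * w (n - j) := by
      calc _ ≤ f * w (n - j) + (a + b - f * (j + 1)) * w (n - j) := by gcongr
        _ = (f + (a + b - f * (j + 1))) * w (n - j) := by ring
        _ = ((a - f * j) + b) * w (n - j) := by
            congr 1
            rw [mul_add, mul_one] at hj'' ⊢
            omega
        _ = _ := by ring
    omega

/-! ### Schrödinger representations and their faithfulness. -/

section Representation

/-- A faithful representation on functions on a finite set gives a matrix representation. -/
theorem hasFaithfulRepOfDim_of_injective {G Ω : Type*} [Group G] [Finite Ω]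
    (T : G →* Module.End ℂ (Ω → ℂ)) (hT : Function.Injective T) :
    HasFaithfulRepOfDim G (Nat.card Ω) := by
  let b : Module.Basis (Fin (Nat.card Ω)) ℂ (Ω → ℂ) :=
    (Pi.basisFun ℂ Ω).reindex (Finite.equivFin Ω)
  let E := LinearMap.toMatrixAlgEquiv b
  refine ⟨(Units.map (E : _ →* _)).comp T.toHomUnits, fun g h hgh => hT ?_⟩
  exact E.injective (congrArg Units.val hgh)

variable {k : ℕ}

/-- The direct sum of the Schrödinger representations attached to characters of images of `R`. -/
def schroedinger {R : Type*} [CommRing R] {I : Type*} (S : I → Type*) [∀ i, CommRing (S i)]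
    (π : ∀ i, R →+* S i) (ψ : ∀ i, AddChar (S i) ℂ) :
    Heis k R →* Module.End ℂ ((Σ i, Fin k → S i) → ℂ) where
  toFun g :=
    { toFun := fun φ t => ψ t.1 (π t.1 (heisZ g) + t.2 ⬝ᵥ (π t.1 ∘ heisY g)) *
        φ ⟨t.1, t.2 + π t.1 ∘ heisX g⟩
      map_add' := fun φ φ' => by ext; simp [mul_add]
      map_smul' := fun c φ => by ext; simp [mul_left_comm] }
  map_one' := by
    ext φ ⟨i, t⟩
    have h (s : Fin k → S i) : s + π i ∘ heisX (1 : Heis k R) = s := by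
      ext j; simp [← heisMk_zero]
    have h' : π i ∘ heisY (1 : Heis k R) = 0 := by
      ext j; simp [← heisMk_zero]
    have h'' : heisZ (1 : Heis k R) = 0 := by
      simp [← heisMk_zero]
    simp [h, h', h'']
  map_mul' g g' := by
    obtain ⟨x, y, z, rfl⟩ := exists_eq_heisMk g
    obtain ⟨x', y', z', rfl⟩ := exists_eq_heisMk g'
    refine LinearMap.ext fun φ => funext fun ⟨i, t⟩ => ?_
    have h1 : π i ∘ (x + x') = π i ∘ x + π i ∘ x' := by ext; simp
    have h2 : π i ∘ (y + y') = π i ∘ y + π i ∘ y' := by ext; simp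
    have h3 : π i (x ⬝ᵥ y') = (π i ∘ x) ⬝ᵥ (π i ∘ y') := RingHom.map_dotProduct _ _ _
    simp only [heisMk_mul, heisX_heisMk, heisY_heisMk, heisZ_heisMk, LinearMap.coe_mk,
      AddHom.coe_mk, Module.End.mul_apply, h1, h2, map_add, h3, ← mul_assoc,
      ← AddChar.map_add_eq_mul, add_assoc, dotProduct_add, add_dotProduct]
    congr 2
    ring

theorem schroedinger_apply {R : Type*} [CommRing R] {I : Type*} (S : I → Type*)
    [∀ i, CommRing (S i)] (π : ∀ i, R →+* S i) (ψ : ∀ i, AddChar (S i) ℂ) (g : Heis k R)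
    (φ : (Σ i, Fin k → S i) → ℂ) (i : I) (t : Fin k → S i) :
    schroedinger S π ψ g φ ⟨i, t⟩ =
      ψ i (π i (heisZ g) + t ⬝ᵥ (π i ∘ heisY g)) * φ ⟨i, t + π i ∘ heisX g⟩ := rfl

theorem schroedinger_injective {R : Type*} [CommRing R] {I : Type*} (S : I → Type*)
    [∀ i, CommRing (S i)] (π : ∀ i, R →+* S i) (ψ : ∀ i, AddChar (S i) ℂ)
    (h : ∀ z ≠ 0, ∃ i, ψ i (π i z) ≠ 1) :
    Function.Injective (schroedinger (k := k) S π ψ) := by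
  classical
  have h' {z : R} (hz : ∀ i, ψ i (π i z) = 1) : z = 0 := by
    by_contra h0
    obtain ⟨i, hi⟩ := h z h0
    exact hi (hz i)
  rw [injective_iff_map_eq_one]
  intro g hg
  obtain ⟨x, y, z, rfl⟩ := exists_eq_heisMk g
  have key (φ : (Σ i, Fin k → S i) → ℂ) (i : I) (t : Fin k → S i) :
      ψ i (π i z + t ⬝ᵥ (π i ∘ y)) * φ ⟨i, t + π i ∘ x⟩ = φ ⟨i, t⟩ := by
    simpa [schroedinger_apply] using congrFun (LinearMap.congr_fun hg φ) ⟨i, t⟩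
  -- The constant function 1 at t = 0 sees only z; at the points t = π s it then isolates s·y.
  have hz : z = 0 := h' fun i => by simpa using key 1 i 0
  subst hz
  have hy : y = 0 := by
    refine dotProduct_eq_zero y fun s => h' fun i => ?_
    rw [dotProduct_comm, RingHom.map_dotProduct]
    simpa using key 1 i (π i ∘ s)
  subst hy
  have hπ : ∀ i, π i ∘ (0 : Fin k → R) = 0 := fun i => by ext; simp
  have hx : x = 0 := by
    funext j
    refine h' fun i => ?_
    -- Only translations are left, and a point mass is fixed only by the zero translation.
    have := key (Pi.single ⟨i, 0⟩ 1) i 0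
    simp only [hπ, dotProduct_zero, map_zero, add_zero, zero_add, AddChar.map_zero_eq_one, one_mul,
      Pi.single_eq_same] at this
    have h0 : π i ∘ x = 0 := by
      by_contra hne
      rw [Pi.single_eq_of_ne (by simpa using hne)] at this
      exact zero_ne_one this
    rw [show π i (x j) = 0 from congrFun h0 j, AddChar.map_zero_eq_one]
  subst hx
  exact heisMk_zero

end Representation

/-! ### Quotients of a discrete valuation ring by powers of its maximal ideal. -/

section DiscreteValuationRing

open IsLocalRing

open IsDiscreteValuationRing hiding maximalIdeal

variable {O : Type*} [CommRing O] [IsDomain O] [IsDiscreteValuationRing O]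

theorem mem_maximalIdeal_pow_iff {a : O} {m : ℕ} :
    a ∈ maximalIdeal O ^ m ↔ (m : ℕ∞) ≤ addVal O a := by
  obtain ⟨ϖ, hϖ⟩ := exists_irreducible O
  rw [hϖ.maximalIdeal_eq, Ideal.span_singleton_pow, Ideal.mem_span_singleton,
    ← addVal_le_iff_dvd, hϖ.addVal_pow]

theorem dvd_of_notMem_maximalIdeal_pow {a c : O} {m : ℕ} (ha : a ∉ maximalIdeal O ^ (m + 1))
    (hc : c ∈ maximalIdeal O ^ m) : a ∣ c := by
  rw [mem_maximalIdeal_pow_iff, not_le, Nat.cast_add, Nat.cast_one] at ha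
  rw [mem_maximalIdeal_pow_iff] at hc
  exact addVal_le_iff_dvd.1 ((Order.le_of_lt_add_one ha).trans hc)

theorem natCard_quotient_maximalIdeal_pow (m : ℕ) :
    Nat.card (O ⧸ maximalIdeal O ^ m) = Nat.card (ResidueField O) ^ m := by
  have := cardQuot_pow_of_prime (P := maximalIdeal O) (not_a_field O) (i := m)
  rwa [Submodule.cardQuot_apply, Submodule.cardQuot_apply] at this

theorem finite_quotient_maximalIdeal_pow [Finite (ResidueField O)] (m : ℕ) :
    Finite (O ⧸ maximalIdeal O ^ m) :=
  Nat.finite_of_card_ne_zero (by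
    rw [natCard_quotient_maximalIdeal_pow]
    exact pow_ne_zero _ Nat.card_pos.ne')

/-- The image of `𝔪 ^ a` in `O ⧸ 𝔪 ^ m`. -/
def layer (O : Type*) [CommRing O] [IsLocalRing O] (a m : ℕ) :
    AddSubgroup (O ⧸ maximalIdeal O ^ m) :=
  ((maximalIdeal O ^ a).map (Ideal.Quotient.mk (maximalIdeal O ^ m))).toAddSubgroup

theorem mem_layer {a m : ℕ} {b : O ⧸ maximalIdeal O ^ m} :
    b ∈ layer O a m ↔ ∃ c ∈ maximalIdeal O ^ a, Ideal.Quotient.mk _ c = b :=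
  Ideal.mem_map_iff_of_surjective _ Ideal.Quotient.mk_surjective

theorem natCard_layer [Finite (ResidueField O)] {a m : ℕ} (h : a ≤ m) :
    Nat.card (layer O a m) = Nat.card (ResidueField O) ^ (m - a) := by
  have h1 := AddSubgroup.card_eq_card_quotient_mul_card_addSubgroup (layer O a m)
  have h2 : Nat.card ((O ⧸ maximalIdeal O ^ m) ⧸ layer O a m) =
      Nat.card (O ⧸ maximalIdeal O ^ a) :=
    Nat.card_congr (DoubleQuot.quotQuotEquivQuotOfLE (Ideal.pow_le_pow_right h)).toEquiv
  rw [h2, natCard_quotient_maximalIdeal_pow, natCard_quotient_maximalIdeal_pow] at h1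
  have hq : 0 < Nat.card (ResidueField O) := Nat.card_pos
  refine Nat.eq_of_mul_eq_mul_left (pow_pos hq a) ?_
  rw [← h1, ← pow_add, Nat.add_sub_cancel' h]

theorem nsmul_mem_layer_eq_zero {p a m ξ : ℕ} (hp : (p : O) ∈ maximalIdeal O ^ ξ)
    (h : m ≤ ξ + a) : ∀ b ∈ layer O a m, p • b = 0 := by
  intro b hb
  obtain ⟨c, hc, rfl⟩ := mem_layer.1 hb
  rw [← map_nsmul, Ideal.Quotient.eq_zero_iff_mem, nsmul_eq_mul]
  exact Ideal.pow_le_pow_right h (pow_add (maximalIdeal O) ξ a ▸ Ideal.mul_mem_mul hp hc)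

theorem natCast_mem_maximalIdeal {p f : ℕ} (hq : Nat.card (ResidueField O) = p ^ f) :
    (p : O) ∈ maximalIdeal O := by
  rw [← residue_eq_zero_iff, map_natCast]
  have h : ((p ^ f : ℕ) : ResidueField O) = 0 := by
    rw [← hq]
    -- In the infinite case `Nat.card` is 0 by convention.
    cases finite_or_infinite (ResidueField O)
    · let _ := Fintype.ofFinite (ResidueField O)
      rw [Nat.card_eq_fintype_card, Nat.cast_card_eq_zero]
    · simp
  rw [Nat.cast_pow] at h
  exact IsReduced.eq_zero _ ⟨f, h⟩

end DiscreteValuationRing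

/-! ### The two bounds over a discrete valuation ring. -/

section Main

open IsLocalRing

open IsDiscreteValuationRing hiding maximalIdeal

variable {O : Type*} [CommRing O] [IsDomain O] [IsDiscreteValuationRing O]

theorem exists_faithful_rep [Finite (ResidueField O)] {p f : ℕ} (hp : p.Prime)
    (hq : Nat.card (ResidueField O) = p ^ f) (k n ξ : ℕ)
    (hξ : (ξ : ℕ∞) = min (addVal O (p : O)) n) :
    HasFaithfulRepOfDim (Heis k (O ⧸ maximalIdeal O ^ n))
      (∑ i ∈ Finset.range ξ, f * Nat.card (ResidueField O) ^ (k * (n - i))) := by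
  have hfin (m : ℕ) : Finite (O ⧸ maximalIdeal O ^ m) := finite_quotient_maximalIdeal_pow m
  have hpm : (p : O) ∈ maximalIdeal O := natCast_mem_maximalIdeal hq
  have hξn : ξ ≤ n := by exact_mod_cast hξ.le.trans (min_le_right _ _)
  -- The bottom layer 𝔪^(m-1)/𝔪^m has order q = p^f and is killed by p; for m = 0 it is trivial.
  have hsep (m : ℕ) : ∃ ψ : Fin f → AddChar (O ⧸ maximalIdeal O ^ m) ℂ,
      ∀ b ∈ layer O (m - 1) m, b ≠ 0 → ∃ j, ψ j b ≠ 1 := by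
    refine exists_separating_chars hp f _
      (nsmul_mem_layer_eq_zero (ξ := 1) (by rwa [pow_one]) (by omega)) ?_
    rw [natCard_layer (Nat.sub_le m 1), hq, ← pow_mul]
    exact Nat.pow_le_pow_right hp.pos 
      ((Nat.mul_le_mul_left f (by omega)).trans (mul_one f).le)
  choose ψ hψ using hsep
  let π (i : Fin ξ × Fin f) : (O ⧸ maximalIdeal O ^ n) →+* O ⧸ maximalIdeal O ^ (n - i.1.1) :=
    Ideal.Quotient.factor (Ideal.pow_le_pow_right (Nat.sub_le _ _))
  have hinj := schroedinger_injective (k := k)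
    (fun i : Fin ξ × Fin f => O ⧸ maximalIdeal O ^ (n - i.1.1)) π (fun i => ψ (n - i.1.1) i.2) (by
      intro z hz
      by_contra! H
      have hnil : ∃ s : ℕ, (p ^ s) • z = 0 := by
        refine ⟨n, ?_⟩
        rw [nsmul_eq_mul, Nat.cast_pow, ← map_natCast (Ideal.Quotient.mk (maximalIdeal O ^ n)),
          ← map_pow, Ideal.Quotient.eq_zero_iff_mem.2 (Ideal.pow_mem_pow hpm n), zero_mul]
      -- Characters trivial at `z` are trivial at its multiples, so `z` may be replaced by its last
      -- nonzero multiple by a power of p.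
      obtain ⟨s, hs, hs'⟩ : ∃ s : ℕ, (p ^ s) • z ≠ 0 ∧ (p ^ (s + 1)) • z = 0 := by
        classical
        have hpos : Nat.find hnil ≠ 0 := fun h0 =>
          hz (by simpa using (Nat.find_eq_zero hnil).1 h0)
        refine ⟨Nat.find hnil - 1, Nat.find_min hnil ?_, ?_⟩
        · omega
        · rw [Nat.sub_add_cancel (by omega)]
          exact Nat.find_spec hnil
      obtain ⟨a, ha⟩ := Ideal.Quotient.mk_surjective ((p ^ s) • z)
      have han : a ∉ maximalIdeal O ^ n := by
        rwa [← Ideal.Quotient.eq_zero_iff_mem, ha]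
      have hpa : (p : O) * a ∈ maximalIdeal O ^ n := by
        rw [← Ideal.Quotient.eq_zero_iff_mem, ← nsmul_eq_mul, map_nsmul, ha, smul_smul,
          ← pow_succ']
        exact hs'
      have haξ : a ∈ maximalIdeal O ^ (n - ξ) := by
        rw [mem_maximalIdeal_pow_iff] at hpa ⊢
        rw [addVal_mul] at hpa
        rcases le_total (addVal O (p : O)) n with hle | hle
        · rw [min_eq_left hle] at hξ
          rw [← hξ] at hpa
          rw [ENat.natCast_sub]
          exact tsub_le_iff_left.2 hpa
        · rw [min_eq_right hle, Nat.cast_inj] at hξ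
          simp [hξ]
      classical
      have hex : ∃ m, a ∉ maximalIdeal O ^ m := ⟨n, han⟩
      -- Here m is the valuation of `a` plus one, so `a` has nonzero image in the bottom layer of
      -- O/𝔪^m.
      obtain ⟨m, hm⟩ : ∃ m, m = Nat.find hex := ⟨_, rfl⟩
      have hmn : m ≤ n := hm ▸ Nat.find_min' hex han
      have ham : a ∉ maximalIdeal O ^ m := hm ▸ Nat.find_spec hex
      have hmξ : n - ξ < m := by
        by_contra! hle
        exact ham (Ideal.pow_le_pow_right hle haξ)
      have ham' : a ∈ maximalIdeal O ^ (m - 1) := by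
        have := Nat.find_min hex (m := m - 1) (by omega)
        simpa using this
      obtain ⟨i, rfl⟩ : ∃ i, m = n - i := ⟨n - m, by omega⟩
      obtain ⟨j, hj⟩ := hψ (n - i) (Ideal.Quotient.mk _ a) (mem_layer.2 ⟨a, ham', rfl⟩)
        (by rwa [Ne, Ideal.Quotient.eq_zero_iff_mem])
      refine hj ?_
      obtain ⟨i', hi', hi⟩ : ∃ i' < ξ, n - i' = n - i := ⟨n - (n - i), by omega, by omega⟩
      have h1 := H (⟨i', hi'⟩, j)
      have h2 : π (⟨i', hi'⟩, j) ((p ^ s) • z) = Ideal.Quotient.mk _ a := by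
        rw [← ha]; rfl
      have h3 : ψ (n - i') j (Ideal.Quotient.mk _ a) = 1 := by
        have : ψ (n - i') j (π (⟨i', hi'⟩, j) ((p ^ s) • z)) = 1 := by
          rw [map_nsmul, AddChar.map_nsmul_eq_pow, h1, one_pow]
        rwa [h2] at this
      rwa [hi] at h3)
  have := hasFaithfulRepOfDim_of_injective _ hinj
  convert this using 1
  rw [Nat.card_sigma, Fintype.sum_prod_type, Finset.sum_range]
  simp [Nat.card_fun, natCard_quotient_maximalIdeal_pow, ← pow_mul, mul_comm k]

/-- The least `m` such that `ψ` is trivial on `𝔪 ^ m`. -/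
noncomputable def charLevel {n : ℕ} (ψ : AddChar (O ⧸ maximalIdeal O ^ n) ℂ) : ℕ :=
  sInf {m | ∀ c ∈ maximalIdeal O ^ m, ψ (Ideal.Quotient.mk _ c) = 1}

theorem mem_trivial_levels {n : ℕ} (ψ : AddChar (O ⧸ maximalIdeal O ^ n) ℂ) :
    n ∈ {m | ∀ c ∈ maximalIdeal O ^ m, ψ (Ideal.Quotient.mk _ c) = 1} := fun c hc => by
  rw [Ideal.Quotient.eq_zero_iff_mem.2 hc, AddChar.map_zero_eq_one]

theorem charLevel_le {n : ℕ} (ψ : AddChar (O ⧸ maximalIdeal O ^ n) ℂ) : charLevel ψ ≤ n :=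
  Nat.sInf_le (mem_trivial_levels ψ)

theorem apply_eq_one_of_charLevel_le {n m : ℕ} (ψ : AddChar (O ⧸ maximalIdeal O ^ n) ℂ)
    (h : charLevel ψ ≤ m) {c : O} (hc : c ∈ maximalIdeal O ^ m) :
    ψ (Ideal.Quotient.mk _ c) = 1 :=
  Nat.sInf_mem ⟨n, mem_trivial_levels ψ⟩ c (Ideal.pow_le_pow_right h hc)

/-- If a ∉ 𝔪^(level ψ), the multiples of a include an element where ψ is nontrivial; hence a pairing
determines its vector modulo 𝔪^(level ψ). -/
theorem pow_charLevel_le_ncard_pairings [Finite (ResidueField O)] (k : ℕ) {n : ℕ}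
    (ψ : AddChar (O ⧸ maximalIdeal O ^ n) ℂ) :
    Nat.card (ResidueField O) ^ (k * charLevel ψ) ≤ (pairings k ψ).ncard := by
  have hfin (m : ℕ) : Finite (O ⧸ maximalIdeal O ^ m) := finite_quotient_maximalIdeal_pow m
  have : Finite (pairings k ψ) := Set.finite_range _
  let F (u : Fin k → O ⧸ maximalIdeal O ^ charLevel ψ) : pairings k ψ :=
    ⟨_, fun i => Ideal.Quotient.mk _ (u i).out, rfl⟩
  have hF : Function.Injective F := by
    intro u u' huu
    by_contra hne
    obtain ⟨i, hi⟩ := Function.ne_iff.1 hne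
    have ha : (u i).out - (u' i).out ∉ maximalIdeal O ^ charLevel ψ := by
      rw [← Ideal.Quotient.mk_eq_mk_iff_sub_mem]
      intro h
      refine hi ?_
      rw [← Quotient.out_eq (u i), ← Quotient.out_eq (u' i)]
      exact h
    obtain ⟨l, hl⟩ : ∃ l, charLevel ψ = l + 1 :=
      Nat.exists_eq_succ_of_ne_zero fun h0 => ha (by simp [h0])
    have hlt : l ∉ {m | ∀ c ∈ maximalIdeal O ^ m, ψ (Ideal.Quotient.mk _ c) = 1} :=
      Nat.notMem_of_lt_sInf (by change l < charLevel ψ; omega)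
    simp only [Set.mem_ofPred_eq, not_forall] at hlt
    obtain ⟨c, hc, hc1⟩ := hlt
    obtain ⟨b, hb⟩ := dvd_of_notMem_maximalIdeal_pow
      (fun h => ha (Ideal.pow_le_pow_right hl.le h)) hc
    have := congrFun (congrArg Subtype.val huu) (Pi.single i (Ideal.Quotient.mk _ b))
    simp only [F, dotProduct_single, ← map_mul] at this
    refine hc1 ?_
    rw [hb, sub_mul, map_sub, AddChar.map_sub_eq_div, this, div_self (ψ.val_isUnit _).ne_zero]
  calc _ = Nat.card (Fin k → O ⧸ maximalIdeal O ^ charLevel ψ) := by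
        rw [Nat.card_fun, natCard_quotient_maximalIdeal_pow, ← pow_mul, mul_comm]; simp
    _ ≤ Nat.card (pairings k ψ) := Nat.card_le_card_of_injective F hF
    _ = _ := Nat.card_coe_set_eq _

theorem le_of_hasFaithfulRepOfDim [Finite (ResidueField O)] {p f : ℕ} (hp : p.Prime)
    (hq : Nat.card (ResidueField O) = p ^ f) (k n ξ : ℕ)
    (hξ : (ξ : ℕ∞) = min (addVal O (p : O)) n) {d : ℕ}
    (h : HasFaithfulRepOfDim (Heis k (O ⧸ maximalIdeal O ^ n)) d) :
    ∑ i ∈ Finset.range ξ, f * Nat.card (ResidueField O) ^ (k * (n - i)) ≤ d := by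
  have hfin : Finite (O ⧸ maximalIdeal O ^ n) := finite_quotient_maximalIdeal_pow n
  have hξn : ξ ≤ n := by exact_mod_cast hξ.le.trans (min_le_right _ _)
  have hpξ : (p : O) ∈ maximalIdeal O ^ ξ :=
    mem_maximalIdeal_pow_iff.2 (hξ.le.trans (min_le_left _ _))
  obtain ⟨S, hS, hd⟩ := exists_centralChars_of_hasFaithfulRepOfDim h
  refine (sum_weight_ge S charLevel (fun l => Nat.card (ResidueField O) ^ (k * l))
    (fun a b hab => Nat.pow_le_pow_right Nat.card_pos (Nat.mul_le_mul_left k hab))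
    f n ξ hξn (fun ψ _ => charLevel_le ψ) fun j hj => ?_).trans
    ((Finset.sum_le_sum fun ψ _ => pow_charLevel_le_ncard_pairings k ψ).trans hd)
  -- Characters of level at most n - j are trivial on this layer, so those of higher level must
  -- already separate it.
  have hcard := card_le_pow_card_of_separating hp (layer O (n - j) n)
    (nsmul_mem_layer_eq_zero (Ideal.pow_le_pow_right hj hpξ) (by omega))
    (S.filter fun ψ => n - j < charLevel ψ) (by
      intro b hb hb0
      obtain ⟨ψ, hψ, h1⟩ := hS b hb0
      obtain ⟨c, hc, rfl⟩ := mem_layer.1 hb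
      refine ⟨ψ, Finset.mem_filter.2 ⟨hψ, ?_⟩, h1⟩
      by_contra! hle
      exact h1 (apply_eq_one_of_charLevel_le ψ hle hc))
  rw [natCard_layer (Nat.sub_le n j), hq, ← pow_mul] at hcard
  have := (Nat.pow_le_pow_iff_right hp.one_lt).1 hcard
  rwa [Nat.sub_sub_self (hj.trans hξn)] at this

end Main

end HeisenbergFaithful

theorem theorem1 (F : Type*) [Field F] [ValuativeRel F] [TopologicalSpace F]
    [IsNonarchimedeanLocalField F]
    (p f : ℕ) (hp : p.Prime) (hq : Nat.card 𝓀[F] = p ^ f) (k n : ℕ) :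
    IsLeast {d : ℕ | HeisenbergFaithful.HasFaithfulRepOfDim
        (HeisenbergFaithful.Heis k (𝒪[F] ⧸ 𝓂[F] ^ n)) d}
      (∑ i ∈ Finset.range (HeisenbergFaithful.xi F p n),
        f * Nat.card 𝓀[F] ^ (k * (n - i))) := by
  have hξ : (HeisenbergFaithful.xi F p n : ℕ∞) =
      min (IsDiscreteValuationRing.addVal 𝒪[F] (p : 𝒪[F])) n :=
    ENat.natCast_toNat (ne_top_of_le_ne_top (ENat.natCast_ne_top n) (min_le_right _ _))
  exact ⟨HeisenbergFaithful.exists_faithful_rep hp hq k n _ hξ,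
    fun d hd => HeisenbergFaithful.le_of_hasFaithfulRepOfDim hp hq k n _ hξ hd⟩
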